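/- **Setting.** Graphs are finite, simple and undirected, with at least one node; $v(G)$ is the number of nodes of $G$. An *admissible pair* $(G,d)$ consists of a graph $G$ and a real number $d\ge 1$ such that all degrees in $G$ are at most $d$; an *admissible sequence* is a sequence of admissible pairs. For a tree $F$, the homomorphism density is $$t(F,G,d)=\frac{\hom(F,G)}{v(G)\,d^{\,v(F)-1}},$$ where $\hom(F,G)$ is the number of graph homomorphisms from $F$ to $G$. A *sub-Markov kernel* on a measurable space $(X,\mathcal B)$ is a map $(x,A)\mapsto \deg_A(x)\in[0,1]$ ($x\in X$, $A\in\mathcal B$) that is measurable in $x$ for every $A$ and such that $\deg(x):A\mapsto\deg_A(x)$ is a measure for every $x$. Its iterates are given by letting $\deg^0(x)$ be the Dirac measure at $x$ and $\deg^{k+1}_A(x)=\int_X\deg_A\,\mathrm d\deg^k(x)$. Let $\lambda$ be a probability measure on $(X,\mathcal B)$. The kernel is *reversible* if $\int_A\deg_B\,\mathrm d\lambda=\int_B\deg_A\,\mathrm d\lambda$ for all $A,B\in\mathcal B$, and *acyclic* if for $\lambda$-a.e. $x\in X$ the measures $\deg^k(x)$ and $\deg(x)$ are mutually singular for all integers $k\ge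 0$, $k\ne 1$. For $\mathbf G=(X,\mathcal B,\lambda,\deg)$ with $\deg$ a reversible sub-Markov kernel and a tree $F$ with $m+1$ nodes, label the nodes by $0,1,\dots,m$ in such a way that every node with label $i\ge 1$ has a (necessarily unique) neighbour with a label $j(i)<i$, and put $$t(F,\mathbf G)=\int_X\int_X\cdots\int_X \mathrm d\deg(x_{j(m)})(x_m)\cdots \mathrm d\deg(x_{j(1)})(x_1)\,\mathrm d\lambda(x_0);$$ this does not depend on the labelling. **Theorem.** Let $(G_n,d_n)$ be an admissible sequence such that $t(F,G_n,d_n)$ converges as $n\to\infty$ for every tree $F$. Then there exists a probability space endowed with an acyclic reversible sub-Markov kernel, $\mathbf G=(X,\mathcal B,\lambda,\deg)$, such that $t(F,G_n,d_n)\to t(F,\mathbf G)$ for every tree $F$ as $n\to\infty$. -/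

import Mathlib

open MeasureTheory ProbabilityTheory Filter Topology
open scoped ENNReal

namespace GraphLimit

section Graphs

/-- `(G, d)` is an admissible pair: `d ≥ 1` is a real number and all degrees of the finite
graph `G` are at most `d`. -/
def IsAdmissiblePair {V : Type*} (G : SimpleGraph V) (d : ℝ) : Prop :=
  1 ≤ d ∧ ∀ v, (Nat.card (G.neighborSet v) : ℝ) ≤ d

/-- The homomorphism density `t(F, G, d) = hom(F, G) / (v(G) * d ^ (v(F) - 1))` of a connected
finite graph `F` in a finite nonempty graph `G` with all degrees at most `d`. -/
noncomputable def homDensity {U V : Type*} (F : SimpleGraph U) (G : SimpleGraph V) (d : ℝ) : ℝ :=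
  (Nat.card (F →g G) : ℝ) / ((Nat.card V : ℝ) * d ^ (Nat.card U - 1))

/-- An admissible labelling of a finite graph `F`: its nodes are listed as
`node 0, node 1, …` in such a way that every node other than `node 0` has a neighbour with a
smaller label (equivalently, every nonempty initial segment of the list spans a connected
subgraph), together with a choice of such a neighbour, the `parent`. If `F` is a tree, the parent
of every node other than `node 0` is uniquely determined by the labelling, and the edges joining
the nodes to their parents are all the edges of `F`. The node labelled `0` is the root. -/
structure AdmissibleLabeling {U : Type*} (F : SimpleGraph U) where
  node : Fin (Nat.card U) ≃ U
  parent : U → U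
  parent_adj : ∀ i, 0 < i.val → F.Adj (parent (node i)) (node i)
  parent_lt : ∀ i, 0 < i.val → node.symm (parent (node i)) < i

/-- Every connected finite graph has an admissible labelling with any prescribed root. -/
theorem AdmissibleLabeling.exists_root {U : Type*} [Finite U] (F : SimpleGraph U)
    (hF : F.Connected) (o : U) :
    ∃ L : AdmissibleLabeling F, ∀ i, i.val = 0 → L.node i = o := by
  classical
  have key : ∀ v, v ≠ o → ∃ w, F.Adj w v ∧ F.dist o w < F.dist o v := by
    intro v hv
    obtain ⟨p, hp⟩ := hF.exists_walk_length_eq_dist v o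
    cases p with
    | nil => exact absurd rfl hv
    | cons h q =>
      refine ⟨_, h.symm, ?_⟩
      have h1 := SimpleGraph.dist_le q
      rw [SimpleGraph.Walk.length_cons, SimpleGraph.dist_comm] at hp
      rw [SimpleGraph.dist_comm] at h1
      omega
  choose! par hpar using key
  let e : Fin (Nat.card U) ≃ U := (Finite.equivFin U).symm
  let σ := Tuple.sort (fun i => F.dist o (e i))
  have hmono : Monotone (fun i => F.dist o (e (σ i))) :=
    Tuple.monotone_sort (fun i => F.dist o (e i))
  have hroot : ∀ i : Fin (Nat.card U), i.val = 0 → e (σ i) = o := by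
    intro i hi
    have h1 := hmono (show i ≤ σ.symm (e.symm o) from Fin.le_def.2 (by omega))
    simp only [Equiv.apply_symm_apply, SimpleGraph.dist_self, Nat.le_zero] at h1
    exact ((hF.dist_eq_zero_iff).1 h1).symm
  have hne : ∀ i : Fin (Nat.card U), 0 < i.val → e (σ i) ≠ o := by
    intro i hi h
    have h2 : e (σ ⟨0, by omega⟩) = e (σ i) := by rw [h]; exact hroot _ rfl
    have h3 := σ.injective (e.injective h2)
    rw [← h3] at hi
    exact absurd hi (lt_irrefl _)
  refine ⟨⟨σ.trans e, par, fun i hi => (hpar _ (hne i hi)).1, fun i hi => ?_⟩, hroot⟩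
  by_contra hlt
  have h1 := hmono (not_lt.1 hlt)
  have h2 := (hpar _ (hne i hi)).2
  simp only [Equiv.symm_trans_apply, Equiv.apply_symm_apply, Equiv.trans_apply] at h1
  exact absurd h2 (not_lt.2 h1)

end Graphs

section Kernels

variable {X : Type*} [MeasurableSpace X]

/-- A sub-Markov kernel `deg` on `X`: `deg x` is a measure of total mass at most `1` for all `x`
(and `x ↦ deg x A` is measurable for all measurable `A`, as for every `Kernel`). -/
def IsSubMarkov (deg : Kernel X X) : Prop :=
  ∀ x, deg x Set.univ ≤ 1

/-- The iterates of a kernel: `deg⁰ x` is the Dirac measure at `x`, and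
`deg^(k+1) x A = ∫ deg y A d(deg^k x)(y)`. -/
noncomputable def iterKernel (deg : Kernel X X) : ℕ → Kernel X X
  | 0 => Kernel.id
  | k + 1 => deg ∘ₖ iterKernel deg k

/-- The kernel `deg` is acyclic with respect to `P`: for `P`-almost every `x`, the measures
`deg^k x` and `deg x` are mutually singular for all `k ≥ 0` with `k ≠ 1`. -/
def IsAcyclicKernel (deg : Kernel X X) (P : Measure X) : Prop :=
  ∀ᵐ x ∂P, ∀ k : ℕ, k ≠ 1 → iterKernel deg k x ⟂ₘ deg x

open Classical in
/-- Iterated integration over the positions of the nodes in a list, from left to right: each node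
`v` is placed at a point `y` distributed according to `deg (x (parent v))`, where `x` records the
positions of the nodes placed so far. The innermost integrand is `1`. -/
noncomputable def iteratedIntegral {U : Type*} (deg : Kernel X X) (parent : U → U) :
    List U → (U → X) → ℝ≥0∞
  | [], _ => 1
  | v :: l, x =>
      ∫⁻ y, iteratedIntegral deg parent l (Function.update x v y) ∂(deg (x (parent v)))

/-- The rooted homomorphism density `t((F, o), (X, x₀))` of a finite tree `F`, rooted at the node
`o = L.node 0`:
`∫ ⋯ ∫ d(deg x_{j(m)})(x_m) ⋯ d(deg x_{j(1)})(x_1)`, where `m + 1` is the number of nodes and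
`j(i)` is the label of the parent of the node with label `i`. -/
noncomputable def rootedTreeDensity {U : Type*} {F : SimpleGraph U} (L : AdmissibleLabeling F)
    (deg : Kernel X X) (x₀ : X) : ℝ≥0∞ :=
  iteratedIntegral deg L.parent (List.ofFn L.node).tail (fun _ => x₀)

/-- The (unrooted) homomorphism density of a finite tree in a probability space `(X, P)` with a
reversible sub-Markov kernel: the expectation of the rooted density at a `P`-random point. -/
noncomputable def treeDensity {U : Type*} {F : SimpleGraph U} (L : AdmissibleLabeling F)
    (deg : Kernel X X) (P : Measure X) : ℝ :=
  (∫⁻ x₀, rootedTreeDensity L deg x₀ ∂P).toReal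

end Kernels

end GraphLimit

/-! A finite graph carries the uniform measure and the kernel giving each neighbour of a point mass
`1 / d`. This kernel is sub-Markov because degrees are at most `d`, and reversible because adjacency
is symmetric. Its tree densities are exactly the homomorphism densities (`treeDensity_graphKernel`),
since placing the nodes of a tree one at a time counts homomorphisms.

The limit is built in two steps. First, the ultraproduct of the graphs with its Loeb measure carries
the ultraproduct of the kernels. Integration commutes with ultralimits of functions bounded by `1`
(`lintegral_ulim`), so reversibility survives (`isReversible_loebKernel`) and tree densities become
ultralimits (`treeDensity_loebKernel`). As the densities converge, these ultralimits are the actual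
limits. This kernel need not be acyclic.

Second, acyclicity is forced by taking the product with a reversible Markov kernel. The extra
coordinate integrates out of every tree density because its total mass is `1`
(`treeDensity_parallelComp`). The factor is a random walk on the compact group of maps from `ℚ` to
`ZMod 2`, with an atomless step law on the set of Dedekind cuts. For `w ≠ 0` only finitely many cuts
remain cuts after adding `w` (`finite_setOf_cut_add_mem_range`). Hence two or more steps almost
surely do not amount to one step, and one step almost surely moves the walk; this is acyclicity,
whatever the first factor is (`isAcyclicKernel_parallelComp_cutKernel`). -/

namespace GraphLimit

/-! ### Ultralimits, Loeb measures and integration on an ultraproduct -/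

section Ultraproducts

/-- The limit of a sequence in `[0, ∞]` along the fixed non-principal ultrafilter on `ℕ`. -/
noncomputable def ulim (f : ℕ → ℝ≥0∞) : ℝ≥0∞ :=
  (Ultrafilter.map f (hyperfilter ℕ)).lim

theorem tendsto_ulim (f : ℕ → ℝ≥0∞) : Tendsto f (hyperfilter ℕ) (𝓝 (ulim f)) :=
  (Ultrafilter.map f (hyperfilter ℕ)).le_nhds_lim

theorem ulim_eq {f : ℕ → ℝ≥0∞} {a : ℝ≥0∞} (h : Tendsto f (hyperfilter ℕ) (𝓝 a)) : ulim f = a :=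
  tendsto_nhds_unique (tendsto_ulim f) h

theorem ulim_const (a : ℝ≥0∞) : ulim (fun _ => a) = a := ulim_eq tendsto_const_nhds

theorem ulim_congr {f g : ℕ → ℝ≥0∞} (h : ∀ᶠ n in hyperfilter ℕ, f n = g n) : ulim f = ulim g :=
  ulim_eq ((tendsto_ulim g).congr' (h.mono fun _ hn => hn.symm))

theorem ulim_mono {f g : ℕ → ℝ≥0∞} (h : ∀ᶠ n in hyperfilter ℕ, f n ≤ g n) : ulim f ≤ ulim g :=
  le_of_tendsto_of_tendsto (tendsto_ulim f) (tendsto_ulim g) h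

theorem ulim_add (f g : ℕ → ℝ≥0∞) : ulim (fun n => f n + g n) = ulim f + ulim g :=
  ulim_eq ((tendsto_ulim f).add (tendsto_ulim g))

theorem ulim_sum {ι : Type*} (s : Finset ι) (f : ι → ℕ → ℝ≥0∞) :
    ulim (fun n => ∑ i ∈ s, f i n) = ∑ i ∈ s, ulim (f i) :=
  ulim_eq (tendsto_finsetSum s fun i _ => tendsto_ulim (f i))

theorem ulim_const_mul {c : ℝ≥0∞} (hc : c ≠ ∞) (f : ℕ → ℝ≥0∞) :
    ulim (fun n => c * f n) = c * ulim f :=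
  ulim_eq (ENNReal.Tendsto.const_mul (tendsto_ulim f) (Or.inr hc))

/-- Sequences of points, to be thought of as representing the points of the ultraproduct. -/
def Ultraproduct (W : ℕ → Type*) : Type _ := ∀ n, W n

variable {W : ℕ → Type*}

/-- The set of the points of the ultraproduct that belong to an ultraproduct of sets. -/
def internalSet (A : ∀ n, Set (W n)) : Set (Ultraproduct W) :=
  {x | ∀ᶠ n in hyperfilter ℕ, x n ∈ A n}

/-- The Loeb sigma-algebra, generated by the internal sets. -/
instance : MeasurableSpace (Ultraproduct W) :=
  MeasurableSpace.generateFrom (Set.range internalSet)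

theorem measurableSet_internalSet (A : ∀ n, Set (W n)) : MeasurableSet (internalSet A) :=
  MeasurableSpace.measurableSet_generateFrom ⟨A, rfl⟩

theorem internalSet_univ : internalSet (fun n => (Set.univ : Set (W n))) = Set.univ := by
  simp [internalSet]

theorem internalSet_empty : internalSet (fun n => (∅ : Set (W n))) = ∅ := by
  simp [internalSet, (hyperfilter ℕ).neBot.ne]

theorem internalSet_inter (A B : ∀ n, Set (W n)) :
    internalSet (fun n => A n ∩ B n) = internalSet A ∩ internalSet B := by
  ext x; simp [internalSet, eventually_and]

theorem internalSet_union (A B : ∀ n, Set (W n)) :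
    internalSet (fun n => A n ∪ B n) = internalSet A ∪ internalSet B := by
  ext x; simp [internalSet, Ultrafilter.eventually_or]

theorem internalSet_compl (A : ∀ n, Set (W n)) :
    internalSet (fun n => (A n)ᶜ) = (internalSet A)ᶜ := by
  ext x
  exact Ultrafilter.eventually_not

theorem isSetRing_internalSet : IsSetRing (Set.range (internalSet (W := W))) where
  empty_mem := ⟨_, internalSet_empty⟩
  union_mem := by
    rintro _ _ ⟨A, rfl⟩ ⟨B, rfl⟩
    exact ⟨_, internalSet_union A B⟩
  sdiff_mem := by
    rintro _ _ ⟨A, rfl⟩ ⟨B, rfl⟩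
    exact ⟨fun n => A n ∩ (B n)ᶜ, by rw [internalSet_inter, internalSet_compl]; rfl⟩

theorem isPiSystem_internalSet : IsPiSystem (Set.range (internalSet (W := W))) :=
  fun _ hs _ ht _ => isSetRing_internalSet.inter_mem hs ht

theorem internalSet_setOf_le (f : ∀ n, W n → ℝ≥0∞) (c : ℝ≥0∞) :
    internalSet (fun n => {y | c ≤ f n y}) ⊆ {x | c ≤ ulim (fun n => f n (x n))} := by
  intro x hx
  exact ge_of_tendsto (tendsto_ulim _) hx

/-- A rational strictly between `c` and the ultralimit is eventually a lower bound of the sequence,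
so each strict superlevel set is a countable union of internal sets. -/
theorem measurable_ulim (f : ∀ n, W n → ℝ≥0∞) :
    Measurable (fun x : Ultraproduct W => ulim (fun n => f n (x n))) := by
  refine measurable_of_Ioi fun c => ?_
  have h : (fun x : Ultraproduct W => ulim (fun n => f n (x n))) ⁻¹' Set.Ioi c =
      ⋃ q ∈ {q : ℚ | c < ENNReal.ofReal q}, internalSet (fun n => {y | ENNReal.ofReal q ≤ f n y}) := by
    ext x
    simp only [Set.mem_preimage, Set.mem_Ioi, Set.mem_iUnion, Set.mem_ofPred_eq]
    constructor
    · intro hx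
      obtain ⟨q, -, h1, h2⟩ := ENNReal.lt_iff_exists_rat_btwn.1 hx
      refine ⟨q, h1, ?_⟩
      filter_upwards [(tendsto_ulim fun n => f n (x n)).eventually_const_lt h2] with n hn
      exact hn.le
    · rintro ⟨q, h1, h2⟩
      exact h1.trans_le (internalSet_setOf_le f _ h2)
  rw [h]
  exact MeasurableSet.biUnion (Set.to_countable _) fun q _ => measurableSet_internalSet _

variable [∀ n, Nonempty (W n)]

/-- Countable saturation of the ultraproduct. -/
theorem eventually_subset_of_internalSet_subset_iUnion {A : ∀ n, Set (W n)}
    {B : ℕ → ∀ n, Set (W n)} (h : internalSet A ⊆ ⋃ k, internalSet (B k)) :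
    ∃ K, ∀ᶠ n in hyperfilter ℕ, A n ⊆ ⋃ k ∈ Finset.range K, B k n := by
  classical
  by_contra! hcon
  let P : ℕ → ℕ → Prop := fun n K => ∃ y ∈ A n, ∀ k < K, y ∉ B k n
  have hP : ∀ K, ∀ᶠ n in hyperfilter ℕ, P n K := by
    intro K
    have h1 := hcon K
    filter_upwards [h1] with n hn
    obtain ⟨y, hy, hy'⟩ := Set.not_subset.1 hn
    refine ⟨y, hy, fun k hk hyk => hy' ?_⟩
    simp only [Set.mem_iUnion, Finset.mem_range]
    exact ⟨k, hk, hyk⟩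
  -- Diagonal choice: in the `n`-th factor avoid as many of the sets `B k n` as possible, up to `n`
  -- of them. Capping at `n` makes the maximum exist; since the ultrafilter is non-principal, `K n`
  -- still eventually exceeds every fixed `k`.
  let K : ℕ → ℕ := fun n => Nat.findGreatest (P n) n
  have hx : ∀ n, ∃ y : W n, P n (K n) → y ∈ A n ∧ ∀ k < K n, y ∉ B k n := by
    intro n
    by_cases hn : P n (K n)
    · obtain ⟨y, hy⟩ := hn
      exact ⟨y, fun _ => hy⟩
    · exact ⟨Classical.arbitrary _, fun h => absurd h hn⟩
  choose x hx using hx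
  have hxA : x ∈ internalSet A := by
    change ∀ᶠ n in hyperfilter ℕ, x n ∈ A n
    filter_upwards [hP 0] with n hn
    exact (hx n (Nat.findGreatest_spec (Nat.zero_le n) hn)).1
  obtain ⟨k, hk⟩ := Set.mem_iUnion.1 (h hxA)
  have hge : ∀ᶠ n in hyperfilter ℕ, k + 1 ≤ n :=
    (Nat.hyperfilter_le_atTop) (eventually_ge_atTop (k + 1))
  have : ∀ᶠ _ in (hyperfilter ℕ : Filter ℕ), False := by
    filter_upwards [hk, hge, hP (k + 1)] with n h1 h2 h3
    exact (hx n (Nat.findGreatest_spec h2 h3)).2 k (Nat.le_findGreatest h2 h3) h1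
  exact this.exists.elim fun _ h => h

theorem eventually_subset_of_internalSet_subset {A B : ∀ n, Set (W n)}
    (h : internalSet A ⊆ internalSet B) : ∀ᶠ n in hyperfilter ℕ, A n ⊆ B n := by
  obtain ⟨K, hK⟩ := eventually_subset_of_internalSet_subset_iUnion (A := A) (B := fun _ => B)
    (h.trans (Set.subset_iUnion (fun _ : ℕ => internalSet B) 0))
  filter_upwards [hK] with n hn
  exact hn.trans (Set.iUnion₂_subset fun _ _ => le_rfl)

variable [∀ n, MeasurableSpace (W n)]

/-- The ultralimit of a sequence of measures, as a function on the internal sets. -/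
noncomputable def loebContent (μ : ∀ n, Measure (W n)) (S : Set (Ultraproduct W)) : ℝ≥0∞ :=
  ⨅ (A : ∀ n, Set (W n)) (_ : internalSet A = S), ulim (fun n => μ n (A n))

/-- The infimum in the definition is over representatives of the same internal set; by saturation
any two of them agree eventually. -/
theorem loebContent_internalSet (μ : ∀ n, Measure (W n)) (A : ∀ n, Set (W n)) :
    loebContent μ (internalSet A) = ulim (fun n => μ n (A n)) := by
  refine le_antisymm (iInf₂_le_of_le A rfl le_rfl) (le_iInf₂ fun B hB => ulim_mono ?_)
  filter_upwards [eventually_subset_of_internalSet_subset hB.ge] with n hn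
  exact measure_mono hn

variable [∀ n, DiscreteMeasurableSpace (W n)]

/-- The ultralimit of a sequence of measures, as an additive content on the internal sets. -/
noncomputable def loebAddContent (μ : ∀ n, Measure (W n)) :
    AddContent ℝ≥0∞ (Set.range (internalSet (W := W))) :=
  isSetRing_internalSet.addContent_of_union (loebContent μ)
    (by rw [← internalSet_empty, loebContent_internalSet]; simp [ulim_const])
    (by
      rintro _ _ ⟨A, rfl⟩ ⟨B, rfl⟩ hAB
      rw [← internalSet_union, loebContent_internalSet, loebContent_internalSet,
        loebContent_internalSet, ← ulim_add]
      have h1 : internalSet (fun n => A n ∩ B n) ⊆ internalSet fun _ => ∅ := by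
        rw [internalSet_inter, internalSet_empty, hAB.inter_eq]
      refine ulim_congr ?_
      filter_upwards [eventually_subset_of_internalSet_subset h1] with n hn
      exact measure_union (Set.disjoint_iff.2 hn) (.of_discrete))

theorem loebAddContent_internalSet (μ : ∀ n, Measure (W n)) (A : ∀ n, Set (W n)) :
    loebAddContent μ (internalSet A) = ulim (fun n => μ n (A n)) :=
  loebContent_internalSet μ A

/-- Saturation reduces a countable cover of an internal set by internal sets to a finite one, so
finite subadditivity in the factors suffices. -/
theorem isSigmaSubadditive_loebAddContent (μ : ∀ n, Measure (W n)) :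
    (loebAddContent μ).IsSigmaSubadditive := by
  intro f hf hU
  choose B hB using hf
  obtain ⟨A, hA⟩ := hU
  obtain rfl : (fun k => internalSet (B k)) = f := funext hB
  obtain ⟨K, hK⟩ := eventually_subset_of_internalSet_subset_iUnion hA.subset
  rw [← hA]
  simp only [loebAddContent_internalSet]
  calc ulim (fun n => μ n (A n)) ≤ ulim (fun n => ∑ k ∈ Finset.range K, μ n (B k n)) := by
        refine ulim_mono ?_
        filter_upwards [hK] with n hn
        exact (measure_mono hn).trans (measure_biUnion_finset_le _ _)
    _ = ∑ k ∈ Finset.range K, ulim (fun n => μ n (B k n)) := ulim_sum _ _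
    _ ≤ _ := ENNReal.sum_le_tsum _

/-- The Loeb measure of a sequence of measures. -/
noncomputable def loebMeasure (μ : ∀ n, Measure (W n)) : Measure (Ultraproduct W) :=
  (loebAddContent μ).measure isSetRing_internalSet.isSetSemiring le_rfl
    (isSigmaSubadditive_loebAddContent μ)

theorem loebMeasure_internalSet (μ : ∀ n, Measure (W n)) (A : ∀ n, Set (W n)) :
    loebMeasure μ (internalSet A) = ulim (fun n => μ n (A n)) :=
  ((loebAddContent μ).measure_eq _ rfl _ ⟨A, rfl⟩).trans (loebAddContent_internalSet μ A)

theorem loebMeasure_univ (μ : ∀ n, Measure (W n)) :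
    loebMeasure μ Set.univ = ulim (fun n => μ n Set.univ) := by
  rw [← internalSet_univ, loebMeasure_internalSet]

theorem loebMeasure_univ_le_one {μ : ∀ n, Measure (W n)} (h : ∀ n, μ n Set.univ ≤ 1) :
    loebMeasure μ Set.univ ≤ 1 := by
  rw [loebMeasure_univ, ← ulim_const 1]
  exact ulim_mono (.of_forall h)

/-- The step function `⌊N f⌋ / N` approximates a function `f` with values in `[0, 1]`. -/
theorem sum_indicator_level_le {N : ℕ} (hN : N ≠ 0) {a : ℝ≥0∞} (ha : a ≤ 1) :
    (N : ℝ≥0∞)⁻¹ * ∑ j ∈ Finset.range N, (if ((j + 1 : ℕ) : ℝ≥0∞) ≤ N * a then 1 else 0) ≤ a ∧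
    a ≤ (N : ℝ≥0∞)⁻¹ * ∑ j ∈ Finset.range N, (if ((j + 1 : ℕ) : ℝ≥0∞) ≤ N * a then 1 else 0)
      + (N : ℝ≥0∞)⁻¹ := by
  lift a to NNReal using (ha.trans_lt ENNReal.one_lt_top).ne
  have ha' : a ≤ 1 := by exact_mod_cast ha
  have hcount : ∑ j ∈ Finset.range N, (if ((j + 1 : ℕ) : ℝ≥0∞) ≤ N * (a : ℝ≥0∞) then 1 else 0)
      = ((⌊N * a⌋₊ : NNReal) : ℝ≥0∞) := by
    have h1 : ∀ j, (((j + 1 : ℕ) : ℝ≥0∞) ≤ N * (a : ℝ≥0∞)) ↔ j < ⌊(N : NNReal) * a⌋₊ := by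
      intro j
      rw [← Nat.succ_le_iff, Nat.le_floor_iff (by positivity)]
      exact_mod_cast Iff.rfl
    have h2 : ⌊(N : NNReal) * a⌋₊ ≤ N := by
      refine Nat.floor_le_of_le ?_
      simpa using mul_le_mul_of_nonneg_left ha' (Nat.cast_nonneg N)
    simp only [h1]
    rw [Finset.sum_ite, Finset.sum_const_zero, add_zero, Finset.sum_const, nsmul_eq_mul, mul_one]
    have h3 : Finset.filter (fun j => j < ⌊(N : NNReal) * a⌋₊) (Finset.range N)
        = Finset.range ⌊(N : NNReal) * a⌋₊ := by
      ext j; simp only [Finset.mem_filter, Finset.mem_range]; omega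
    rw [h3, Finset.card_range]; simp
  rw [hcount]
  have hN' : (N : NNReal) ≠ 0 := by exact_mod_cast hN
  have hinv : (N : ℝ≥0∞)⁻¹ = (((N : NNReal)⁻¹ : NNReal) : ℝ≥0∞) := by
    rw [ENNReal.coe_inv hN']; simp
  rw [hinv]
  have e : a = (N : NNReal)⁻¹ * (N * a) := by field_simp
  constructor
  · norm_cast
    conv_rhs => rw [e]
    gcongr
    exact Nat.floor_le (by positivity)
  · norm_cast
    conv_lhs => rw [e]
    calc (N : NNReal)⁻¹ * (N * a) ≤ (N : NNReal)⁻¹ * (⌊N * a⌋₊ + 1) := by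
          gcongr; exact (Nat.lt_floor_add_one _).le
      _ = _ := by ring

/-- The integral of an ultralimit of functions is the ultralimit of the integrals. -/
theorem lintegral_ulim {μ : ∀ n, Measure (W n)} (hμ : ∀ n, μ n Set.univ ≤ 1)
    {f : ∀ n, W n → ℝ≥0∞} (hf : ∀ n y, f n y ≤ 1) :
    ∫⁻ x, ulim (fun n => f n (x n)) ∂(loebMeasure μ) = ulim (fun n => ∫⁻ y, f n y ∂(μ n)) := by
  classical
  -- A combination of indicators of level sets within `1 / N` of `f`. For it the claim is the
  -- formula for the Loeb measure of internal sets, and as all total masses are at most `1`, the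
  -- error in the integrals is at most `1 / N`.
  let g : ℕ → ∀ n, W n → ℝ≥0∞ := fun N n y =>
    (N : ℝ≥0∞)⁻¹ * ∑ j ∈ Finset.range N, (if ((j + 1 : ℕ) : ℝ≥0∞) ≤ N * f n y then 1 else 0)
  have hNt : ∀ N : ℕ, N ≠ 0 → (N : ℝ≥0∞)⁻¹ ≠ ∞ := fun N hN =>
    ENNReal.inv_ne_top.2 (by exact_mod_cast hN)
  have hg : ∀ N : ℕ, N ≠ 0 → ∫⁻ x, ulim (fun n => g N n (x n)) ∂(loebMeasure μ)
      = ulim (fun n => ∫⁻ y, g N n y ∂(μ n)) := by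
    intro N hN
    let A : ℕ → ∀ n, Set (W n) := fun j n => {y | ((j + 1 : ℕ) : ℝ≥0∞) ≤ N * f n y}
    have h1 : ∀ x : Ultraproduct W, ulim (fun n => g N n (x n))
        = (N : ℝ≥0∞)⁻¹ * ∑ j ∈ Finset.range N, (internalSet (A j)).indicator 1 x := by
      intro x
      rw [ulim_const_mul (hNt N hN), ulim_sum]
      congr 1
      refine Finset.sum_congr rfl fun j _ => ?_
      by_cases hx : x ∈ internalSet (A j)
      · rw [Set.indicator_of_mem hx, Pi.one_apply]
        refine (ulim_congr ?_).trans (ulim_const 1)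
        filter_upwards [hx] with n hn
        exact if_pos hn
      · rw [Set.indicator_of_notMem hx]
        refine (ulim_congr ?_).trans (ulim_const 0)
        filter_upwards [Ultrafilter.eventually_not.2 hx] with n hn
        exact if_neg hn
    have h2 : ∀ n, ∫⁻ y, g N n y ∂(μ n)
        = (N : ℝ≥0∞)⁻¹ * ∑ j ∈ Finset.range N, μ n (A j n) := by
      intro n
      simp only [g]
      rw [lintegral_const_mul _ .of_discrete, lintegral_finsetSum _ fun _ _ => .of_discrete]
      congr 1
      refine Finset.sum_congr rfl fun j _ => ?_
      rw [← lintegral_indicator_one (μ := μ n) (s := A j n) .of_discrete]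
      refine lintegral_congr fun y => ?_
      simp [A, Set.indicator_apply]
    simp only [h1, h2]
    rw [lintegral_const_mul _ (Finset.measurable_sum _ fun j _ =>
        measurable_one.indicator (measurableSet_internalSet _)),
      lintegral_finsetSum _ fun j _ => measurable_one.indicator (measurableSet_internalSet _),
      ulim_const_mul (hNt N hN), ulim_sum]
    congr 1
    refine Finset.sum_congr rfl fun j _ => ?_
    rw [lintegral_indicator_one (measurableSet_internalSet _), loebMeasure_internalSet]
  have hle : ∀ N : ℕ, N ≠ 0 → ∀ n y, g N n y ≤ f n y ∧ f n y ≤ g N n y + (N : ℝ≥0∞)⁻¹ :=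
    fun N hN n y => sum_indicator_level_le hN (hf n y)
  have hlim : Tendsto (fun N : ℕ => (N : ℝ≥0∞)⁻¹) atTop (𝓝 0) := ENNReal.tendsto_inv_nat_nhds_zero
  apply le_antisymm
  · have key : ∀ N : ℕ, N ≠ 0 → ∫⁻ x, ulim (fun n => f n (x n)) ∂(loebMeasure μ)
        ≤ ulim (fun n => ∫⁻ y, f n y ∂(μ n)) + (N : ℝ≥0∞)⁻¹ := by
      intro N hN
      calc ∫⁻ x, ulim (fun n => f n (x n)) ∂(loebMeasure μ)
          ≤ ∫⁻ x, (ulim (fun n => g N n (x n)) + (N : ℝ≥0∞)⁻¹) ∂(loebMeasure μ) := by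
            refine lintegral_mono fun x => ?_
            rw [← ulim_const (N : ℝ≥0∞)⁻¹, ← ulim_add]
            exact ulim_mono (.of_forall fun n => (hle N hN n _).2)
        _ = ulim (fun n => ∫⁻ y, g N n y ∂(μ n)) + (N : ℝ≥0∞)⁻¹ * loebMeasure μ Set.univ := by
            rw [lintegral_add_right _ measurable_const, hg N hN, lintegral_const]
        _ ≤ ulim (fun n => ∫⁻ y, f n y ∂(μ n)) + (N : ℝ≥0∞)⁻¹ * 1 := by
            gcongr
            · exact ulim_mono (.of_forall fun n => lintegral_mono fun y => (hle N hN n y).1)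
            · exact loebMeasure_univ_le_one hμ
        _ = _ := by rw [mul_one]
    refine ge_of_tendsto (x := atTop) (f := fun N : ℕ =>
      ulim (fun n => ∫⁻ y, f n y ∂(μ n)) + (N : ℝ≥0∞)⁻¹) ?_
      ((eventually_ne_atTop 0).mono key)
    simpa using tendsto_const_nhds.add hlim
  · have key : ∀ N : ℕ, N ≠ 0 → ulim (fun n => ∫⁻ y, f n y ∂(μ n))
        ≤ ∫⁻ x, ulim (fun n => f n (x n)) ∂(loebMeasure μ) + (N : ℝ≥0∞)⁻¹ := by
      intro N hN
      calc ulim (fun n => ∫⁻ y, f n y ∂(μ n))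
          ≤ ulim (fun n => ∫⁻ y, g N n y ∂(μ n) + (N : ℝ≥0∞)⁻¹) := by
            refine ulim_mono (.of_forall fun n => ?_)
            calc ∫⁻ y, f n y ∂(μ n) ≤ ∫⁻ y, (g N n y + (N : ℝ≥0∞)⁻¹) ∂(μ n) :=
                  lintegral_mono fun y => (hle N hN n y).2
              _ = ∫⁻ y, g N n y ∂(μ n) + (N : ℝ≥0∞)⁻¹ * μ n Set.univ := by
                  rw [lintegral_add_right _ measurable_const, lintegral_const]
              _ ≤ ∫⁻ y, g N n y ∂(μ n) + (N : ℝ≥0∞)⁻¹ * 1 := by gcongr; exact hμ n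
              _ = _ := by rw [mul_one]
        _ = ∫⁻ x, ulim (fun n => g N n (x n)) ∂(loebMeasure μ) + (N : ℝ≥0∞)⁻¹ := by
            rw [ulim_add, ulim_const, hg N hN]
        _ ≤ _ := by
            gcongr
            exact ulim_mono (.of_forall fun n => (hle N hN n _).1)
    refine ge_of_tendsto (x := atTop) (f := fun N : ℕ =>
      ∫⁻ x, ulim (fun n => f n (x n)) ∂(loebMeasure μ) + (N : ℝ≥0∞)⁻¹) ?_
      ((eventually_ne_atTop 0).mono key)
    simpa using tendsto_const_nhds.add hlim

end Ultraproducts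

/-! ### Reversibility on generators; bounds and measurability of iterated integrals -/

section Reversible

variable {X : Type*} [mX : MeasurableSpace X]

/-- Reversibility of a kernel may be checked on a generating π-system. -/
theorem isReversible_of_isPiSystem {C : Set (Set X)} (hgen : mX = MeasurableSpace.generateFrom C)
    (hpi : IsPiSystem C) (huniv : Set.univ ∈ C) (κ : Kernel X X) [IsFiniteKernel κ]
    (P : Measure X) [IsFiniteMeasure P]
    (h : ∀ A ∈ C, ∀ B ∈ C, ∫⁻ x in A, κ x B ∂P = ∫⁻ x in B, κ x A ∂P) : κ.IsReversible P := by
  have hmeas : ∀ A ∈ C, MeasurableSet A := fun A hA => by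
    rw [hgen]; exact MeasurableSpace.measurableSet_generateFrom hA
  have hbind : ∀ {A B : Set X}, MeasurableSet A →
      (κ ∘ₘ P.restrict B) A = ∫⁻ x in B, κ x A ∂P := fun hA =>
    Measure.bind_apply hA κ.aemeasurable
  have hdens : ∀ {A B : Set X}, MeasurableSet A →
      P.withDensity (fun x => κ x B) A = ∫⁻ x in A, κ x B ∂P := fun hA => withDensity_apply _ hA
  -- For fixed `B` both sides are finite measures in `A`, so agreement on the π-system gives
  -- agreement everywhere. Used twice: first with `B` a generator, then, by symmetry, with `B`
  -- arbitrary.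
  have step : ∀ B, MeasurableSet B →
      (∀ A ∈ C, ∫⁻ x in A, κ x B ∂P = ∫⁻ x in B, κ x A ∂P) →
      ∀ A, MeasurableSet A → ∫⁻ x in A, κ x B ∂P = ∫⁻ x in B, κ x A ∂P := by
    intro B hB hAB A hA
    have heq : κ ∘ₘ P.restrict B = P.withDensity (fun x => κ x B) := by
      refine ext_of_generate_finite C hgen hpi (fun s hs => ?_) ?_
      · rw [hbind (hmeas s hs), hdens (hmeas s hs), hAB s hs]
      · rw [hbind .univ, hdens .univ, hAB _ huniv]
    rw [← hbind hA, ← hdens hA, heq]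
  intro A B hA hB
  refine step B hB (fun A' hA' => ?_) A hA
  exact (step A' (hmeas A' hA') (fun B' hB' => h B' hB' A' hA') B hB).symm

theorem IsSubMarkov.isFiniteKernel {κ : Kernel X X} (h : IsSubMarkov κ) : IsFiniteKernel κ :=
  ⟨1, ENNReal.one_lt_top, h⟩

theorem iteratedIntegral_le_one {U : Type*} {κ : Kernel X X} (h : IsSubMarkov κ) (parent : U → U)
    (l : List U) (x : U → X) : iteratedIntegral κ parent l x ≤ 1 := by
  induction l generalizing x with
  | nil => exact le_rfl
  | cons v l ih =>
    calc iteratedIntegral κ parent (v :: l) x ≤ ∫⁻ _, 1 ∂(κ (x (parent v))) :=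
          lintegral_mono fun y => ih _
      _ ≤ 1 := by rw [lintegral_one]; exact h _

theorem measurable_iteratedIntegral {U : Type*} (κ : Kernel X X) [IsSFiniteKernel κ]
    (parent : U → U) (l : List U) : Measurable (iteratedIntegral κ parent l) := by
  classical
  induction l with
  | nil => exact measurable_const
  | cons v l ih =>
    exact Measurable.lintegral_kernel_prod_right'
      (κ := κ.comap (fun x : U → X => x (parent v)) (measurable_pi_apply _))
      (by convert! ih.comp (measurable_update' (a := v)))

end Reversible

/-! ### Ultraproducts of sub-Markov kernels -/

section LoebKernels

variable {W : ℕ → Type*} [∀ n, Nonempty (W n)] [∀ n, MeasurableSpace (W n)]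
  [∀ n, DiscreteMeasurableSpace (W n)]

/-- The ultraproduct of a sequence of sub-Markov kernels on discrete spaces. -/
noncomputable def loebKernel (κ : ∀ n, Kernel (W n) (W n)) (hκ : ∀ n, IsSubMarkov (κ n)) :
    Kernel (Ultraproduct W) (Ultraproduct W) where
  toFun x := loebMeasure fun n => κ n (x n)
  measurable' := by
    have hle : ∀ x : Ultraproduct W, loebMeasure (fun n => κ n (x n)) Set.univ ≤ 1 := fun x =>
      loebMeasure_univ_le_one fun n => hκ n (x n)
    have : ∀ x : Ultraproduct W, IsFiniteMeasure (loebMeasure fun n => κ n (x n)) := fun x =>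
      ⟨(hle x).trans_lt ENNReal.one_lt_top⟩
    refine Measurable.measure_of_isPiSystem rfl isPiSystem_internalSet ?_ ?_
    · rintro _ ⟨A, rfl⟩
      simp only [loebMeasure_internalSet]
      exact measurable_ulim fun n y => κ n y (A n)
    · simp only [loebMeasure_univ]
      exact measurable_ulim fun n y => κ n y Set.univ

theorem loebKernel_apply (κ : ∀ n, Kernel (W n) (W n)) (hκ : ∀ n, IsSubMarkov (κ n))
    (x : Ultraproduct W) : loebKernel κ hκ x = loebMeasure fun n => κ n (x n) := rfl

theorem isSubMarkov_loebKernel (κ : ∀ n, Kernel (W n) (W n)) (hκ : ∀ n, IsSubMarkov (κ n)) :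
    IsSubMarkov (loebKernel κ hκ) :=
  fun x => loebMeasure_univ_le_one fun n => hκ n (x n)

theorem isProbabilityMeasure_loebMeasure (P : ∀ n, Measure (W n))
    [∀ n, IsProbabilityMeasure (P n)] : IsProbabilityMeasure (loebMeasure P) :=
  ⟨by simp [loebMeasure_univ, ulim_const]⟩

theorem isReversible_loebKernel (κ : ∀ n, Kernel (W n) (W n)) (hκ : ∀ n, IsSubMarkov (κ n))
    (P : ∀ n, Measure (W n)) [∀ n, IsProbabilityMeasure (P n)]
    (h : ∀ n, (κ n).IsReversible (P n)) : (loebKernel κ hκ).IsReversible (loebMeasure P) := by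
  classical
  have := (isSubMarkov_loebKernel κ hκ).isFiniteKernel
  have := isProbabilityMeasure_loebMeasure P
  -- The integrand, cut off to `internalSet A`, is itself an ultralimit of functions bounded by `1`,
  -- so `lintegral_ulim` applies.
  have key : ∀ A B : ∀ n, Set (W n),
      ∫⁻ x in internalSet A, loebKernel κ hκ x (internalSet B) ∂(loebMeasure P)
        = ulim fun n => ∫⁻ y in A n, κ n y (B n) ∂(P n) := by
    intro A B
    rw [← lintegral_indicator (measurableSet_internalSet A)]
    have h1 : ∀ x : Ultraproduct W, (internalSet A).indicator
        (fun x => loebKernel κ hκ x (internalSet B)) x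
        = ulim fun n => (A n).indicator (fun y => κ n y (B n)) (x n) := by
      intro x
      by_cases hx : x ∈ internalSet A
      · rw [Set.indicator_of_mem hx, loebKernel_apply, loebMeasure_internalSet]
        refine ulim_congr ?_
        filter_upwards [hx] with n hn
        rw [Set.indicator_of_mem hn]
      · rw [Set.indicator_of_notMem hx]
        refine ((ulim_congr ?_).trans (ulim_const 0)).symm
        filter_upwards [Ultrafilter.eventually_not.2 hx] with n hn
        exact Set.indicator_of_notMem hn _
    simp only [h1]
    rw [lintegral_ulim (fun n => prob_le_one)]
    · refine ulim_congr (.of_forall fun n => ?_)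
      rw [lintegral_indicator .of_discrete]
    · intro n y
      exact Set.indicator_le' (fun y _ => (measure_mono (Set.subset_univ _)).trans (hκ n y))
        (fun _ _ => zero_le_one) y
  refine isReversible_of_isPiSystem rfl isPiSystem_internalSet ⟨_, internalSet_univ⟩ _ _ ?_
  rintro _ ⟨A, rfl⟩ _ ⟨B, rfl⟩
  rw [key, key]
  exact ulim_congr (.of_forall fun n => h n .of_discrete .of_discrete)

/-- Each layer of integration commutes with the ultralimit by `lintegral_ulim`, the inner integrals
being at most `1`. -/
theorem iteratedIntegral_loebKernel {U : Type*} (κ : ∀ n, Kernel (W n) (W n))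
    (hκ : ∀ n, IsSubMarkov (κ n)) (parent : U → U) (l : List U) (x : U → Ultraproduct W) :
    iteratedIntegral (loebKernel κ hκ) parent l x
      = ulim fun n => iteratedIntegral (κ n) parent l fun u => x u n := by
  classical
  induction l generalizing x with
  | nil => exact (ulim_const 1).symm
  | cons v l ih =>
    have h1 : ∀ y : Ultraproduct W, iteratedIntegral (loebKernel κ hκ) parent l
        (Function.update x v y) = ulim fun n => iteratedIntegral (κ n) parent l
          (Function.update (fun u => x u n) v (y n)) := by
      intro y
      rw [ih]
      congr! 3 with n
      ext u
      by_cases hu : u = v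
      · subst hu; simp
      · simp [hu]
    simp only [iteratedIntegral]
    have h2 := lintegral_ulim (μ := fun n => κ n (x (parent v) n)) (fun n => hκ n _)
      (f := fun n y => iteratedIntegral (κ n) parent l (Function.update (fun u => x u n) v y))
      (fun n y => iteratedIntegral_le_one (hκ n) _ _ _)
    rw [← h2, loebKernel_apply]
    exact lintegral_congr fun y => by convert h1 y

theorem treeDensity_loebKernel {U : Type*} {F : SimpleGraph U} (L : AdmissibleLabeling F)
    (κ : ∀ n, Kernel (W n) (W n)) (hκ : ∀ n, IsSubMarkov (κ n)) (P : ∀ n, Measure (W n))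
    [∀ n, IsProbabilityMeasure (P n)] :
    Tendsto (fun n => treeDensity L (κ n) (P n)) (hyperfilter ℕ)
      (𝓝 (treeDensity L (loebKernel κ hκ) (loebMeasure P))) := by
  have h1 : ∫⁻ x, rootedTreeDensity L (loebKernel κ hκ) x ∂(loebMeasure P)
      = ulim fun n => ∫⁻ y, rootedTreeDensity L (κ n) y ∂(P n) := by
    rw [← lintegral_ulim (fun n => prob_le_one) (f := fun n => rootedTreeDensity L (κ n))
      fun n y => iteratedIntegral_le_one (hκ n) _ _ _]
    exact lintegral_congr fun x => iteratedIntegral_loebKernel κ hκ _ _ _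
  have h2 : ulim (fun n => ∫⁻ y, rootedTreeDensity L (κ n) y ∂(P n)) ≠ ∞ := by
    refine ((ulim_mono (.of_forall fun n => ?_)).trans_lt
      ((ulim_const 1).trans_lt ENNReal.one_lt_top)).ne
    calc ∫⁻ y, rootedTreeDensity L (κ n) y ∂(P n) ≤ ∫⁻ _, 1 ∂(P n) :=
          lintegral_mono fun y => iteratedIntegral_le_one (hκ n) _ _ _
      _ = 1 := by simp
  unfold treeDensity
  rw [h1]
  exact (ENNReal.tendsto_toReal h2).comp (tendsto_ulim _)

end LoebKernels

/-! ### Counting tree homomorphisms node by node -/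

section Homomorphisms

variable {U V : Type*}

open Classical in
/-- The maps that agree with `x` outside the list `l` and send the edges joining the nodes in `l`
to their parents to edges. -/
noncomputable def extensions [Fintype U] [Fintype V] (G : SimpleGraph V) (parent : U → U)
    (l : List U) (x : U → V) : Finset (U → V) :=
  {φ | (∀ u, u ∉ l → φ u = x u) ∧ ∀ v ∈ l, G.Adj (φ (parent v)) (φ v)}

-- Extensions are sorted by the image `y` of `v`. The parent of `v` is outside the list, so its
-- image is already prescribed by `x`.
open Classical in
theorem card_extensions_cons [Fintype U] [Fintype V] (G : SimpleGraph V) {parent : U → U}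
    {v : U} {l : List U} (hv : v ∉ l) (hp : parent v ∉ v :: l) (x : U → V) :
    (extensions G parent (v :: l) x).card = ∑ y, if G.Adj (x (parent v)) y then
      (extensions G parent l (Function.update x v y)).card else 0 := by
  rw [Finset.card_eq_sum_card_fiberwise (f := fun φ => φ v) (t := Finset.univ) (by simp)]
  refine Finset.sum_congr rfl fun y _ => ?_
  split_ifs with hy
  · congr 1
    ext φ
    simp only [extensions, Finset.mem_filter, Finset.mem_univ, true_and, List.mem_cons, not_or,
      forall_eq_or_imp]
    simp only [List.mem_cons, not_or] at hp
    constructor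
    · rintro ⟨⟨h1, h2, h3⟩, h4⟩
      refine ⟨fun u hu => ?_, h3⟩
      by_cases huv : u = v
      · subst huv; simp [h4]
      · rw [Function.update_of_ne huv]; exact h1 u ⟨huv, hu⟩
    · rintro ⟨h1, h2⟩
      have h3 : φ v = y := by rw [h1 v hv, Function.update_self]
      have h4 : φ (parent v) = x (parent v) := by
        rw [h1 _ hp.2, Function.update_of_ne hp.1]
      refine ⟨⟨fun u hu => ?_, ?_, h2⟩, h3⟩
      · rw [h1 u hu.2, Function.update_of_ne hu.1]
      · rw [h3, h4]; exact hy
  · rw [Finset.card_eq_zero, Finset.filter_eq_empty_iff]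
    intro φ hφ h
    simp only [extensions, Finset.mem_filter, Finset.mem_univ, true_and] at hφ
    have h1 := hφ.2 v (by simp)
    rw [hφ.1 _ hp, h] at h1
    exact hy h1

theorem AdmissibleLabeling.mem_tail_iff {F : SimpleGraph U} (L : AdmissibleLabeling F) (v : U) :
    v ∈ (List.ofFn L.node).tail ↔ 0 < (L.node.symm v).val := by
  rw [List.mem_iff_getElem]
  constructor
  · rintro ⟨i, hi, rfl⟩
    simp
  · intro h
    have hlt := (L.node.symm v).isLt
    refine ⟨(L.node.symm v).val - 1, by simp; omega, ?_⟩
    have : (L.node.symm v).val - 1 + 1 = (L.node.symm v).val := by omega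
    simp [this]

theorem AdmissibleLabeling.parent_adj' {F : SimpleGraph U} (L : AdmissibleLabeling F) {v : U}
    (hv : 0 < (L.node.symm v).val) : F.Adj (L.parent v) v := by
  simpa using L.parent_adj (L.node.symm v) hv

theorem AdmissibleLabeling.parent_lt' {F : SimpleGraph U} (L : AdmissibleLabeling F) {v : U}
    (hv : 0 < (L.node.symm v).val) : L.node.symm (L.parent v) < L.node.symm v := by
  simpa using L.parent_lt (L.node.symm v) hv

/-- All edges of a tree join a node to its parent. -/
theorem AdmissibleLabeling.eq_parent_of_adj [Finite U] {F : SimpleGraph U} (hF : F.IsTree)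
    (L : AdmissibleLabeling F) {u w : U} (h : F.Adj u w) :
    ∃ v, 0 < (L.node.symm v).val ∧ s(u, w) = s(L.parent v, v) := by
  classical
  have := Fintype.ofFinite U
  let S : Finset U := {v | 0 < (L.node.symm v).val}
  have hS : S.card + 1 = Fintype.card U := by
    have hpos : 0 < Nat.card U := by
      have := hF.1.nonempty
      exact Nat.card_pos
    have h1 : S = Finset.univ.erase (L.node ⟨0, hpos⟩) := by
      ext v
      simp only [S, Finset.mem_filter, Finset.mem_univ, true_and, Finset.mem_erase, and_true]
      rw [Nat.pos_iff_ne_zero, not_iff_not, ← L.node.symm_apply_eq, Fin.ext_iff]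
    rw [h1, Finset.card_erase_of_mem (Finset.mem_univ _), Finset.card_univ,
      ← Nat.card_eq_fintype_card]
    omega
  have hsub : S.image (fun v => s(L.parent v, v)) ⊆ F.edgeFinset := by
    intro e he
    obtain ⟨v, hv, rfl⟩ := Finset.mem_image.1 he
    rw [SimpleGraph.mem_edgeFinset]
    exact L.parent_adj' (by simpa [S] using hv)
  -- If two nodes gave the same edge with its ends swapped, each would be the parent of the other
  -- and hence precede it.
  have hinj : Set.InjOn (fun v => s(L.parent v, v)) (S : Set U) := by
    intro v hv w hw hvw
    have h1 := L.parent_lt' (v := v) (by simpa [S] using hv)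
    have h2 := L.parent_lt' (v := w) (by simpa [S] using hw)
    rcases Sym2.eq_iff.1 hvw with h | h
    · exact h.2
    · rw [h.1] at h1
      rw [← h.2] at h2
      exact absurd h1 (lt_asymm h2)
  -- The non-root nodes give as many distinct edges as a tree has, namely one less than its number
  -- of nodes.
  have heq := Finset.eq_of_subset_of_card_le hsub (by
    rw [Finset.card_image_of_injOn hinj]
    have := hF.card_edgeFinset
    omega)
  have hmem : s(u, w) ∈ F.edgeFinset := by rwa [SimpleGraph.mem_edgeFinset]
  rw [← heq] at hmem
  obtain ⟨v, hv, hvw⟩ := Finset.mem_image.1 hmem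
  exact ⟨v, by simpa [S] using hv, hvw.symm⟩

/-- Homomorphisms are sorted by the image of the root. In a tree, preserving the edges to parents
already means preserving all edges. -/
theorem card_hom_eq_sum [Fintype U] [Fintype V] {F : SimpleGraph U} (hF : F.IsTree)
    (L : AdmissibleLabeling F) (G : SimpleGraph V) :
    Nat.card (F →g G)
      = ∑ x, (extensions G L.parent (List.ofFn L.node).tail fun _ => x).card := by
  classical
  have hpos : 0 < Nat.card U := by
    have := hF.1.nonempty
    exact Nat.card_pos
  let H : Finset (U → V) := {φ | ∀ u w, F.Adj u w → G.Adj (φ u) (φ w)}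
  have h1 : Nat.card (F →g G) = H.card := by
    rw [← Fintype.card_coe H, ← Nat.card_eq_fintype_card]
    refine Nat.card_congr ⟨fun f => ⟨f, by simpa [H] using fun u w h => f.map_adj h⟩,
      fun φ => ⟨φ.1, fun {u w} h => (Finset.mem_filter.1 φ.2).2 u w h⟩, fun _ => rfl, fun _ => rfl⟩
  rw [h1, Finset.card_eq_sum_card_fiberwise (f := fun φ => φ (L.node ⟨0, hpos⟩))
    (t := Finset.univ) (by simp)]
  refine Finset.sum_congr rfl fun x _ => ?_
  congr 1
  ext φ
  simp only [H, extensions, Finset.mem_filter, Finset.mem_univ, true_and, L.mem_tail_iff]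
  rw [and_comm]
  refine and_congr ?_ ?_
  · constructor
    · intro h u hu
      rw [← h]
      congr 1
      rw [← L.node.symm_apply_eq, Fin.ext_iff]
      simpa using hu
    · intro h
      exact h _ (by simp)
  · constructor
    · intro h v hv
      exact h _ _ (L.parent_adj' hv)
    · intro h u w huw
      obtain ⟨v, hv, hvw⟩ := L.eq_parent_of_adj hF huw
      rcases Sym2.eq_iff.1 hvw with ⟨rfl, rfl⟩ | ⟨rfl, rfl⟩
      · exact h _ hv
      · exact (h _ hv).symm

end Homomorphisms

/-! ### The kernel of a finite graph and its tree densities -/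

section FiniteGraphs

variable {U V : Type*} [MeasurableSpace V] [DiscreteMeasurableSpace V]

/-- The random walk kernel of a finite graph, killed so that every edge has weight `1 / d`. -/
noncomputable def graphKernel (G : SimpleGraph V) (d : ℝ) : Kernel V V where
  toFun x := (ENNReal.ofReal d)⁻¹ • Measure.count.restrict (G.neighborSet x)
  measurable' := .of_discrete

open Classical in
theorem lintegral_graphKernel [Fintype V] (G : SimpleGraph V) (d : ℝ) (x : V) (f : V → ℝ≥0∞) :
    ∫⁻ y, f y ∂(graphKernel G d x)
      = (ENNReal.ofReal d)⁻¹ * ∑ y, if G.Adj x y then f y else 0 := by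
  change ∫⁻ y, f y ∂((ENNReal.ofReal d)⁻¹ • Measure.count.restrict (G.neighborSet x)) = _
  rw [lintegral_smul_measure, smul_eq_mul, ← lintegral_indicator .of_discrete, lintegral_count,
    tsum_fintype]
  simp [Set.indicator_apply]

theorem isSubMarkov_graphKernel [Finite V] {G : SimpleGraph V} {d : ℝ}
    (h : IsAdmissiblePair G d) : IsSubMarkov (graphKernel G d) := by
  intro x
  change ((ENNReal.ofReal d)⁻¹ • Measure.count.restrict (G.neighborSet x)) Set.univ ≤ 1
  have h0 : ENNReal.ofReal d ≠ 0 := by simpa using zero_lt_one.trans_le h.1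
  rw [Measure.smul_apply, Measure.restrict_apply_univ, smul_eq_mul, Measure.count_apply .of_discrete,
    mul_comm, ← div_eq_mul_inv, ENNReal.div_le_iff h0 ENNReal.ofReal_ne_top, one_mul]
  have h1 := ENNReal.ofReal_le_ofReal (h.2 x)
  rw [ENNReal.ofReal_natCast] at h1
  refine le_trans (le_of_eq ?_) h1
  rw [Nat.card_coe_set_eq, ← (Set.toFinite _).cast_ncard_eq]
  rfl

/-- The uniform probability measure on a finite set. -/
noncomputable def uniformMeasure (V : Type*) [MeasurableSpace V] : Measure V :=
  (Nat.card V : ℝ≥0∞)⁻¹ • Measure.count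

theorem lintegral_uniformMeasure [Fintype V] (f : V → ℝ≥0∞) :
    ∫⁻ y, f y ∂(uniformMeasure V) = (Nat.card V : ℝ≥0∞)⁻¹ * ∑ y, f y := by
  rw [uniformMeasure, lintegral_smul_measure, smul_eq_mul, lintegral_count, tsum_fintype]

instance [Finite V] [Nonempty V] : IsProbabilityMeasure (uniformMeasure V) := by
  have := Fintype.ofFinite V
  refine ⟨?_⟩
  rw [← lintegral_one, lintegral_uniformMeasure]
  simp only [Finset.sum_const, nsmul_eq_mul, mul_one, Finset.card_univ, Nat.card_eq_fintype_card]
  exact ENNReal.inv_mul_cancel (by simp) (by simp)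

/-- Up to a common factor, both sides count ordered adjacent pairs between the two sets. -/
theorem isReversible_graphKernel [Finite V] (G : SimpleGraph V) (d : ℝ) :
    (graphKernel G d).IsReversible (uniformMeasure V) := by
  classical
  have := Fintype.ofFinite V
  have key : ∀ A B : Set V, ∫⁻ x in A, graphKernel G d x B ∂(uniformMeasure V)
      = (Nat.card V : ℝ≥0∞)⁻¹ * ((ENNReal.ofReal d)⁻¹ *
        ∑ x, ∑ y, if G.Adj x y ∧ x ∈ A ∧ y ∈ B then (1 : ℝ≥0∞) else 0) := by
    intro A B
    rw [← lintegral_indicator .of_discrete, lintegral_uniformMeasure,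
      Finset.mul_sum (a := (ENNReal.ofReal d)⁻¹)]
    refine congrArg _ (Finset.sum_congr rfl fun x _ => ?_)
    by_cases hx : x ∈ A
    · rw [Set.indicator_of_mem hx, ← lintegral_indicator_one .of_discrete, lintegral_graphKernel]
      refine congrArg _ (Finset.sum_congr rfl fun y _ => ?_)
      simp only [Set.indicator_apply, hx, true_and, ite_and, Pi.one_apply]
    · simp [hx]
  intro A B _ _
  rw [key, key, Finset.sum_comm]
  refine congrArg _ (congrArg _
    (Finset.sum_congr rfl fun x _ => Finset.sum_congr rfl fun y _ => ?_))
  simp only [G.adj_comm y x, and_comm (a := y ∈ A)]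

/-- The rank `r` encodes that nodes are placed in increasing order and parents before children, so
no node is placed twice and a parent is never still to be placed. Each placement contributes one
factor `1 / d`. -/
theorem iteratedIntegral_graphKernel [Fintype U] [Fintype V] (G : SimpleGraph V) (d : ℝ)
    {parent : U → U} (r : U → ℕ) {l : List U} (hl : l.Pairwise fun u v => r u < r v)
    (hp : ∀ v ∈ l, r (parent v) < r v) (x : U → V) :
    iteratedIntegral (graphKernel G d) parent l x
      = (ENNReal.ofReal d)⁻¹ ^ l.length * (extensions G parent l x).card := by
  classical
  induction l generalizing x with
  | nil =>
    have : extensions G parent [] x = {x} := by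
      ext φ
      simp [extensions, funext_iff]
    simp [iteratedIntegral, this]
  | cons v l ih =>
    rw [List.pairwise_cons] at hl
    simp only [List.mem_cons, forall_eq_or_imp] at hp
    have hv : v ∉ l := fun h => lt_irrefl _ (hl.1 v h)
    have hpv : parent v ∉ v :: l := by
      intro h
      rcases List.mem_cons.1 h with h | h
      · exact absurd hp.1 (by rw [h]; exact lt_irrefl _)
      · exact lt_asymm hp.1 (hl.1 _ h)
    simp only [iteratedIntegral]
    rw [lintegral_graphKernel, card_extensions_cons G hv hpv, List.length_cons, pow_succ',
      mul_assoc, Nat.cast_sum, Finset.mul_sum (a := (ENNReal.ofReal d)⁻¹ ^ l.length)]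
    congr 1
    refine Finset.sum_congr rfl fun y _ => ?_
    split_ifs with hy
    · rw [← ih hl.2 hp.2]
    · simp

theorem treeDensity_graphKernel [Finite U] [Finite V] {F : SimpleGraph U} (hF : F.IsTree)
    (L : AdmissibleLabeling F) {G : SimpleGraph V} {d : ℝ} (hd : 0 ≤ d) :
    treeDensity L (graphKernel G d) (uniformMeasure V) = homDensity F G d := by
  have := Fintype.ofFinite U
  have := Fintype.ofFinite V
  have h1 : ∀ x, rootedTreeDensity L (graphKernel G d) x = (ENNReal.ofReal d)⁻¹ ^ (Nat.card U - 1)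
      * (extensions G L.parent (List.ofFn L.node).tail fun _ => x).card := by
    intro x
    unfold rootedTreeDensity
    rw [iteratedIntegral_graphKernel G d (fun u => (L.node.symm u).val) ?_ ?_]
    · simp
    · refine List.Pairwise.tail ?_
      rw [List.pairwise_ofFn]
      intro i j hij
      simpa using hij
    · intro v hv
      exact L.parent_lt' ((L.mem_tail_iff v).1 hv)
  unfold treeDensity homDensity
  simp only [h1]
  rw [lintegral_uniformMeasure, ← Finset.mul_sum, ← Nat.cast_sum, ← card_hom_eq_sum hF]
  simp only [ENNReal.toReal_mul, ENNReal.toReal_inv, ENNReal.toReal_natCast, ENNReal.toReal_pow,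
    ENNReal.toReal_ofReal hd]
  rw [inv_pow, div_eq_mul_inv, mul_inv]
  ring

end FiniteGraphs

/-! ### A reversible random walk whose steps form a Sidon set -/

section Walk

/-- The Dedekind cut of a real number, as an element of a compact group of exponent `2`. -/
noncomputable def cut (t : ℝ) : ℚ → ZMod 2 := fun q => if (q : ℝ) < t then 1 else 0

theorem measurable_cut : Measurable cut :=
  measurable_pi_lambda _ fun _ =>
    Measurable.ite (measurableSet_lt measurable_const measurable_id) measurable_const
      measurable_const

/-- Cuts at points other than `t` do not vary near `t`. -/
theorem exists_rat_cut_eq (t : ℝ) (S : Finset ℝ) (hS : t ∉ S) :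
    ∃ q q' : ℚ, cut t q = 1 ∧ cut t q' = 0 ∧ ∀ u ∈ S, cut u q = cut u q' := by
  -- Take `q` and `q'` on either side of `t`, in a ball that misses `S`: a cut takes different
  -- values at them only if its point lies between them.
  obtain ⟨ε, hε, hball⟩ := Metric.isOpen_iff.1 S.finite_toSet.isClosed.isOpen_compl t (by simpa)
  obtain ⟨q, h1, h2⟩ := exists_rat_btwn (show t - ε < t by linarith)
  obtain ⟨q', h3, h4⟩ := exists_rat_btwn (show t < t + ε by linarith)
  refine ⟨q, q', if_pos h2, if_neg (not_lt.2 h3.le), fun u hu => ?_⟩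
  have hu' : u ∉ Metric.ball t ε := fun h => hball h (by simpa using hu)
  rw [Metric.mem_ball, Real.dist_eq, not_lt, le_abs] at hu'
  unfold cut
  rcases hu' with h | h
  · rw [if_pos (by linarith), if_pos (by linarith)]
  · rw [if_neg (by linarith), if_neg (by linarith)]

theorem cut_injective : Function.Injective cut := by
  intro t s h
  by_contra hne
  obtain ⟨q, q', h1, h2, h3⟩ := exists_rat_cut_eq t {s} (by simpa using hne)
  have h4 := h3 s (by simp)
  rw [← h, h1, h2] at h4
  exact one_ne_zero h4

theorem measurableSet_range_cut : MeasurableSet (Set.range cut) :=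
  (measurable_cut.measurableEmbedding cut_injective).measurableSet_range

/-- The set of all cuts is a Sidon set. -/
theorem finite_setOf_cut_add_mem_range {w : ℚ → ZMod 2} (hw : w ≠ 0) :
    {t | cut t + w ∈ Set.range cut}.Finite := by
  rcases Set.eq_empty_or_nonempty {t | cut t + w ∈ Set.range cut} with h | ⟨t₀, s₀, h₀⟩
  · rw [h]; exact Set.finite_empty
  refine (Set.toFinite {t₀, s₀}).subset ?_
  rintro t ⟨s, hs⟩
  by_contra hcon
  simp only [Set.mem_insert_iff, Set.mem_singleton_iff, not_or] at hcon
  have hts : t ≠ s := by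
    rintro rfl
    exact hw (by simpa using hs)
  -- Near `t` the cuts at `t₀` and `s₀` are constant, hence so is their difference `w`. Then `cut s
  -- = cut t + w` must jump at `t`, yet `s ≠ t`.
  obtain ⟨q, q', h1, h2, h3⟩ := exists_rat_cut_eq t {t₀, s₀, s} (by simp [hcon, hts])
  have e0 : ∀ p, cut s₀ p = cut t₀ p + w p := fun p => congrFun h₀ p
  have e1 : ∀ p, cut s p = cut t p + w p := fun p => congrFun hs p
  have h5 : w q = w q' := by
    have := h3 s₀ (by simp)
    rw [e0, e0, h3 t₀ (by simp)] at this
    exact add_left_cancel this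
  have h6 := h3 s (by simp)
  rw [e1, e1, h1, h2, h5] at h6
  exact one_ne_zero (add_right_cancel h6)

/-- The law of the cut at a uniform random point of `[0, 1]`. -/
noncomputable def cutLaw : Measure (ℚ → ZMod 2) :=
  (volume.restrict (Set.Icc (0 : ℝ) 1)).map cut

instance : IsProbabilityMeasure cutLaw := by
  have : IsProbabilityMeasure (volume.restrict (Set.Icc (0 : ℝ) 1)) := ⟨by simp⟩
  exact Measure.isProbabilityMeasure_map measurable_cut.aemeasurable

theorem cutLaw_eq_zero {s : Set (ℚ → ZMod 2)} (hs : MeasurableSet s)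
    (h : (cut ⁻¹' s).Countable) : cutLaw s = 0 := by
  rw [cutLaw, Measure.map_apply measurable_cut hs]
  exact h.measure_zero _

theorem cutLaw_singleton (h : ℚ → ZMod 2) : cutLaw {h} = 0 :=
  cutLaw_eq_zero (measurableSet_singleton h)
    ((Set.subsingleton_singleton.preimage cut_injective).finite.countable)

theorem cutLaw_compl_range : cutLaw (Set.range cut)ᶜ = 0 :=
  cutLaw_eq_zero measurableSet_range_cut.compl (by simp)

/-- The random walk on the compact group of all maps `ℚ → ℤ/2` whose steps are random cuts. -/
noncomputable def cutKernel : Kernel (ℚ → ZMod 2) (ℚ → ZMod 2) where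
  toFun g := cutLaw.map (g + ·)
  measurable' := by
    refine Measure.measurable_of_measurable_coe _ fun s hs => ?_
    simp only [Measure.map_apply (measurable_const_add _) hs]
    exact measurable_measure_prodMk_left (measurable_add hs)

theorem cutKernel_apply (g : ℚ → ZMod 2) {s : Set (ℚ → ZMod 2)} (hs : MeasurableSet s) :
    cutKernel g s = cutLaw ((g + ·) ⁻¹' s) :=
  Measure.map_apply (measurable_const_add _) hs

instance : IsMarkovKernel cutKernel :=
  ⟨fun _ => Measure.isProbabilityMeasure_map (measurable_const_add _).aemeasurable⟩

/-- The normalized Haar measure on the compact group of all maps `ℚ → ℤ/2`. -/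
noncomputable def cutHaar : Measure (ℚ → ZMod 2) := Measure.addHaarMeasure ⊤

instance : IsProbabilityMeasure cutHaar :=
  ⟨by simpa [cutHaar] using Measure.addHaarMeasure_self (G := ℚ → ZMod 2) (K₀ := ⊤)⟩

instance : cutHaar.IsAddLeftInvariant :=
  inferInstanceAs (Measure.addHaarMeasure (G := ℚ → ZMod 2) ⊤).IsAddLeftInvariant

/-- Every step `h` is its own inverse. After exchanging the integrals, translating the invariant
measure by `h` swaps the roles of the two sets. -/
theorem isReversible_cutKernel : cutKernel.IsReversible cutHaar := by
  have key : ∀ A B : Set (ℚ → ZMod 2), MeasurableSet A → MeasurableSet B →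
      ∫⁻ g in A, cutKernel g B ∂cutHaar
        = ∫⁻ h, ∫⁻ g, A.indicator 1 g * B.indicator 1 (h + g) ∂cutHaar ∂cutLaw := by
    intro A B hA hB
    rw [lintegral_lintegral_swap, ← lintegral_indicator hA]
    · refine lintegral_congr fun g => ?_
      have hm : Measurable fun h => (B.indicator 1 (h + g) : ℝ≥0∞) :=
        (measurable_one.indicator hB).comp (measurable_add_const g)
      rw [lintegral_const_mul _ hm]
      by_cases hg : g ∈ A
      · rw [Set.indicator_of_mem hg, Set.indicator_of_mem hg, Pi.one_apply, one_mul,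
          cutKernel_apply g hB, ← lintegral_indicator_one (measurable_const_add g hB)]
        refine lintegral_congr fun h => ?_
        rw [add_comm h g]
        rfl
      · simp [hg]
    · exact (((measurable_one.indicator hA).comp measurable_snd).mul
        ((measurable_one.indicator hB).comp (measurable_fst.add measurable_snd))).aemeasurable
  intro A B hA hB
  rw [key A B hA hB, key B A hB hA]
  refine lintegral_congr fun h => ?_
  rw [← lintegral_add_left_eq_self _ h]
  refine lintegral_congr fun g => ?_
  have h2 : h + (h + g) = g := by
    rw [← add_assoc, CharTwo.add_self_eq_zero, zero_add]
  rw [h2, mul_comm]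

end Walk

/-! ### Products of kernels and acyclicity -/

section Products

variable {X Y : Type*} [MeasurableSpace X] [MeasurableSpace Y]

theorem IsSubMarkov.parallelComp {κ : Kernel X X} (h : IsSubMarkov κ) (η : Kernel Y Y)
    [IsMarkovKernel η] : IsSubMarkov (κ ∥ₖ η) := by
  have := h.isFiniteKernel
  intro z
  rw [Kernel.parallelComp_apply, ← Set.univ_prod_univ, Measure.prod_prod, measure_univ (μ := η z.2),
    mul_one]
  exact h _

theorem isReversible_parallelComp {κ : Kernel X X} [IsFiniteKernel κ] {P : Measure X}
    [IsFiniteMeasure P] (hκ : κ.IsReversible P) {η : Kernel Y Y} [IsFiniteKernel η] {Q : Measure Y}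
    [IsFiniteMeasure Q] (hη : η.IsReversible Q) : (κ ∥ₖ η).IsReversible (P.prod Q) := by
  refine isReversible_of_isPiSystem generateFrom_prod.symm isPiSystem_prod
    ⟨Set.univ, .univ, Set.univ, .univ, Set.univ_prod_univ⟩ _ _ ?_
  rintro _ ⟨A, hA, A', hA', rfl⟩ _ ⟨B, hB, B', hB', rfl⟩
  have key : ∀ (A B : Set X) (A' B' : Set Y), MeasurableSet B → MeasurableSet B' →
      ∫⁻ z in A ×ˢ A', (κ ∥ₖ η) z (B ×ˢ B') ∂(P.prod Q)
        = (∫⁻ x in A, κ x B ∂P) * ∫⁻ y in A', η y B' ∂Q := by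
    intro A B A' B' hB hB'
    rw [← Measure.prod_restrict, ← lintegral_prod_mul (κ.measurable_coe hB).aemeasurable
      (η.measurable_coe hB').aemeasurable]
    simp only [Kernel.parallelComp_apply, Measure.prod_prod]
  rw [key _ _ _ _ hB hB', key _ _ _ _ hA hA', hκ hA hB, hη hA' hB']

theorem lintegral_prod_fst {f : X → ℝ≥0∞} (hf : Measurable f) (P : Measure X) (Q : Measure Y)
    [IsProbabilityMeasure Q] : ∫⁻ z, f z.1 ∂(P.prod Q) = ∫⁻ x, f x ∂P := by
  rw [lintegral_prod (fun z : X × Y => f z.1) (hf.comp measurable_fst).aemeasurable]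
  simp

/-- By induction the inner integral depends only on first coordinates, and the Markov factor `η`
integrates out with mass `1`. -/
theorem iteratedIntegral_parallelComp {U : Type*} (κ : Kernel X X) [IsFiniteKernel κ]
    (η : Kernel Y Y) [IsMarkovKernel η] (parent : U → U) (l : List U) (z : U → X × Y) :
    iteratedIntegral (κ ∥ₖ η) parent l z = iteratedIntegral κ parent l fun u => (z u).1 := by
  classical
  induction l generalizing z with
  | nil => rfl
  | cons v l ih =>
    have hm : Measurable fun x => iteratedIntegral κ parent l
        (Function.update (fun u => (z u).1) v x) :=
      (measurable_iteratedIntegral κ parent l).comp (measurable_update _)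
    have h1 : ∀ y : X × Y, (fun u => (Function.update z v y u).1)
        = Function.update (fun u => (z u).1) v y.1 := by
      intro y
      ext u
      by_cases hu : u = v
      · subst hu; simp
      · simp [hu]
    calc iteratedIntegral (κ ∥ₖ η) parent (v :: l) z
        = ∫⁻ y, iteratedIntegral κ parent l (Function.update (fun u => (z u).1) v y.1)
            ∂((κ (z (parent v)).1).prod (η (z (parent v)).2)) := by
          rw [← Kernel.parallelComp_apply]
          refine lintegral_congr fun y => ?_
          rw [ih, ← h1]
      _ = ∫⁻ x, iteratedIntegral κ parent l (Function.update (fun u => (z u).1) v x)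
            ∂(κ (z (parent v)).1) := by
          rw [lintegral_prod_fst hm]
      _ = _ := by
          refine lintegral_congr fun y => ?_
          congr!

theorem treeDensity_parallelComp {U : Type*} {F : SimpleGraph U} (L : AdmissibleLabeling F)
    (κ : Kernel X X) [IsFiniteKernel κ] (P : Measure X) [SFinite P] (η : Kernel Y Y)
    [IsMarkovKernel η] (Q : Measure Y) [IsProbabilityMeasure Q] :
    treeDensity L (κ ∥ₖ η) (P.prod Q) = treeDensity L κ P := by
  have hm : Measurable (rootedTreeDensity L κ) :=
    (measurable_iteratedIntegral κ _ _).comp (measurable_pi_lambda _ fun _ => measurable_id)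
  have h1 : ∀ z, rootedTreeDensity L (κ ∥ₖ η) z = rootedTreeDensity L κ z.1 :=
    fun z => iteratedIntegral_parallelComp κ η _ _ _
  unfold treeDensity
  simp only [h1]
  rw [lintegral_prod_fst hm]

/-- The product of any finite kernel with the random walk with steps in a Sidon set is acyclic. -/
theorem isAcyclicKernel_parallelComp_cutKernel (κ : Kernel X X) [IsFiniteKernel κ]
    (P : Measure (X × (ℚ → ZMod 2))) : IsAcyclicKernel (κ ∥ₖ cutKernel) P := by
  have hprod : ∀ (z : X × (ℚ → ZMod 2)) {T : Set (ℚ → ZMod 2)}, cutKernel z.2 T = 0 →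
      (κ ∥ₖ cutKernel) z (Set.univ ×ˢ T) = 0 := by
    intro z T hT
    rw [Kernel.parallelComp_apply, Measure.prod_prod, hT, mul_zero]
  have hsingle : ∀ (g h : ℚ → ZMod 2), cutKernel g {h} = 0 := by
    intro g h
    rw [cutKernel_apply g (measurableSet_singleton h)]
    have : (g + ·) ⁻¹' {h} = {h - g} := by
      ext x
      rw [Set.mem_singleton_iff, eq_sub_iff_add_eq']
      rfl
    rw [this, cutLaw_singleton]
  have hms : ∀ h : ℚ → ZMod 2, MeasurableSet ((Set.univ : Set X) ×ˢ {h}) :=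
    fun h => MeasurableSet.univ.prod (measurableSet_singleton h)
  have hsucc : ∀ (k : ℕ) (z : X × (ℚ → ZMod 2)) {s : Set (X × (ℚ → ZMod 2))}, MeasurableSet s →
      iterKernel (κ ∥ₖ cutKernel) (k + 1) z s
        = ∫⁻ y, (κ ∥ₖ cutKernel) y s ∂(iterKernel (κ ∥ₖ cutKernel) k z) :=
    fun k z s hs => Kernel.comp_apply' _ _ _ hs
  have hiter : ∀ (k : ℕ) z h,
      iterKernel (κ ∥ₖ cutKernel) (k + 1) z ((Set.univ : Set X) ×ˢ {h}) = 0 := by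
    intro k z h
    rw [hsucc k z (hms h)]
    simp only [hprod _ (hsingle _ h), lintegral_zero]
  refine .of_forall fun z k hk => ?_
  obtain _ | _ | k := k
  -- Case `k = 0`: the Dirac measure lives on the fibre over `z.2`, which a single step does not
  -- charge because the step law is atomless.
  · refine Measure.MutuallySingular.mk (s := (Set.univ ×ˢ {z.2})ᶜ) (t := Set.univ ×ˢ {z.2}) ?_
      (hprod z (hsingle _ _)) (by simp)
    change Kernel.id z _ = 0
    rw [Kernel.id_apply, Measure.dirac_apply' _ (hms z.2).compl]
    simp
  · exact absurd rfl hk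
  -- At least two steps: `T` is the set of points one step away from `z.2`, and it carries the law
  -- of a single step. Before the last step the walk is almost surely at some `y.2 ≠ z.2`, and from
  -- there only finitely many parameters `t` lead into `T` by the Sidon property.
  · let T : Set (ℚ → ZMod 2) := {h | h - z.2 ∈ Set.range cut}
    have hT : MeasurableSet T := measurable_sub_const z.2 measurableSet_range_cut
    refine Measure.MutuallySingular.mk (s := Set.univ ×ˢ T) (t := Set.univ ×ˢ Tᶜ) ?_ ?_ ?_
    · rw [hsucc _ z (MeasurableSet.univ.prod hT)]
      refine (lintegral_congr_ae ?_).trans lintegral_zero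
      have hae : ∀ᵐ y ∂(iterKernel (κ ∥ₖ cutKernel) (k + 1) z), y.2 ≠ z.2 := by
        rw [ae_iff]
        convert hiter k z z.2 using 2
        ext y; simp
      filter_upwards [hae] with y hy
      refine hprod y ?_
      rw [cutKernel_apply _ hT]
      refine cutLaw_eq_zero (measurable_const_add _ hT) ?_
      convert (finite_setOf_cut_add_mem_range (sub_ne_zero.2 hy)).countable using 1
      ext t
      simp only [T, Set.mem_preimage, Set.mem_ofPred_eq]
      rw [show y.2 + cut t - z.2 = cut t + (y.2 - z.2) by abel]
    · refine hprod z ?_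
      rw [cutKernel_apply _ hT.compl]
      convert cutLaw_compl_range using 2
      ext h
      simp [T]
    · intro y _
      by_cases hy : y.2 ∈ T
      · exact Or.inl ⟨trivial, hy⟩
      · exact Or.inr ⟨trivial, hy⟩

end Products

/-! ### Relabelling the nodes of the graphs, and the main theorem -/

theorem homDensity_comap_equiv {U V W : Type*} (F : SimpleGraph U) (G : SimpleGraph V)
    (e : W ≃ V) (d : ℝ) : homDensity F (G.comap e) d = homDensity F G d := by
  unfold homDensity
  rw [Nat.card_congr e]
  congr 2
  exact Nat.card_congr ⟨fun f => (SimpleGraph.Iso.comap e G).toHom.comp f,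
    fun f => (SimpleGraph.Iso.comap e G).symm.toHom.comp f, fun f => by ext; simp,
    fun f => by ext; simp⟩

theorem IsAdmissiblePair.comap_equiv {V W : Type*} {G : SimpleGraph V} {d : ℝ}
    (h : IsAdmissiblePair G d) (e : W ≃ V) : IsAdmissiblePair (G.comap e) d :=
  ⟨h.1, fun v => by
    rw [Nat.card_congr ((SimpleGraph.Iso.comap e G).mapNeighborSet v)]
    exact h.2 _⟩

end GraphLimit

theorem mainTheorem8 {V : ℕ → Type*} [∀ n, Finite (V n)] [∀ n, Nonempty (V n)]
    (G : ∀ n, SimpleGraph (V n)) (d : ℕ → ℝ)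
    (hadm : ∀ n, GraphLimit.IsAdmissiblePair (G n) (d n))
    (hconv : ∀ (U : Type) [Finite U] (F : SimpleGraph U), F.IsTree →
      ∃ t : ℝ, Tendsto (fun n => GraphLimit.homDensity F (G n) (d n)) atTop (𝓝 t)) :
    ∃ (X : Type) (_ : MeasurableSpace X) (P : Measure X) (deg : Kernel X X),
      IsProbabilityMeasure P ∧
      GraphLimit.IsSubMarkov deg ∧
      deg.IsReversible P ∧
      GraphLimit.IsAcyclicKernel deg P ∧
      ∀ (U : Type) [Finite U] (F : SimpleGraph U), F.IsTree →
        ∀ L : GraphLimit.AdmissibleLabeling F,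
          Tendsto (fun n => GraphLimit.homDensity F (G n) (d n)) atTop
            (𝓝 (GraphLimit.treeDensity L deg P)) := by
  -- The node sets may live in any universe; isomorphic copies on `Fin` place the limit space in
  -- `Type`.
  let W : ℕ → Type := fun n => Fin (Nat.card (V n))
  let e : ∀ n, W n ≃ V n := fun n => (Finite.equivFin (V n)).symm
  have : ∀ n, Nonempty (W n) := fun n => (e n).nonempty
  let _ : ∀ n, MeasurableSpace (W n) := fun _ => ⊤
  have : ∀ n, DiscreteMeasurableSpace (W n) := fun _ => ⟨fun _ => trivial⟩
  let κ : ∀ n, Kernel (W n) (W n) := fun n => GraphLimit.graphKernel ((G n).comap (e n)) (d n)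
  have hκ : ∀ n, GraphLimit.IsSubMarkov (κ n) := fun n =>
    GraphLimit.isSubMarkov_graphKernel ((hadm n).comap_equiv (e n))
  let P := GraphLimit.loebMeasure fun n => GraphLimit.uniformMeasure (W n)
  have : IsProbabilityMeasure P := GraphLimit.isProbabilityMeasure_loebMeasure _
  have hsub := GraphLimit.isSubMarkov_loebKernel κ hκ
  have := hsub.isFiniteKernel
  refine ⟨GraphLimit.Ultraproduct W × (ℚ → ZMod 2), inferInstance, P.prod GraphLimit.cutHaar,
    GraphLimit.loebKernel κ hκ ∥ₖ GraphLimit.cutKernel, inferInstance, hsub.parallelComp _,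
    GraphLimit.isReversible_parallelComp (GraphLimit.isReversible_loebKernel κ hκ _ fun n =>
      GraphLimit.isReversible_graphKernel _ _) GraphLimit.isReversible_cutKernel,
    GraphLimit.isAcyclicKernel_parallelComp_cutKernel _ _, fun U _ F hF L => ?_⟩
  obtain ⟨t, ht⟩ := hconv U F hF
  have h1 := GraphLimit.treeDensity_loebKernel L κ hκ fun n => GraphLimit.uniformMeasure (W n)
  have h2 : ∀ n, GraphLimit.treeDensity L (κ n) (GraphLimit.uniformMeasure (W n))
      = GraphLimit.homDensity F (G n) (d n) := fun n => by
    rw [GraphLimit.treeDensity_graphKernel hF L (zero_le_one.trans (hadm n).1),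
      GraphLimit.homDensity_comap_equiv]
  simp only [h2] at h1
  rw [GraphLimit.treeDensity_parallelComp]
  -- The assumed limit `t` along `atTop` is also the limit along the ultrafilter, hence equals the
  -- tree density of the Loeb kernel.
  rwa [← tendsto_nhds_unique (ht.mono_left Nat.hyperfilter_le_atTop) h1]
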